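/- Let $\mathbb{R}^\infty=\bigcup_{n\ge 1}\mathbb{R}^n$. An additive machine in $\mathsf{M}_{\rm add}^1$ is a register machine with registers $Z_1,Z_2,\dots$ for real numbers and finitely many index registers $I_1,\dots,I_k$ for positive integers, whose program is a finite list of instructions of the forms $Z_i:=Z_j+Z_k$; $Z_i:=Z_j-Z_k$; $Z_j:=0$; $Z_j:=1$; if $Z_j\ge 0$ then goto $l_1$ else goto $l_2$; $Z_{I_j}:=Z_{I_k}$; $I_j:=1$; $I_j:=I_j+1$; if $I_j=I_k$ then goto $l_1$ else goto $l_2$; together with a stop instruction. On input $(x_1,\dots,x_n)$ it starts with $Z_m=x_m$ for $m\le n$, $Z_m=0$ for $m>n$, and all index registers equal to $n$; if it stops, its output is $(Z_1,\dots,Z_{I_1})$. For an oracle $\mathcal{O}\subseteq\mathbb{R}^\infty$, a machine in $\mathsf{M}_{\rm add}^1(\mathcal{O})$ may in addition use instructions "if $(Z_1,\dots,Z_{I_1})\in\mathcal{O}$ then goto $l_1$ else goto $l_2$". For $\mathcal{A},\mathcal{B}\subseteq\mathbb{R}^\infty$ write $\mathcal{A}\preceq\mathcal{B}$ (strong Turing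 reduction) if some machine in $\mathsf{M}_{\rm add}^1(\mathcal{B})$ decides $\mathcal{A}$, that is, computes its characteristic function. A machine semi-decides $\mathcal{A}$ if it outputs $1$ on every input in $\mathcal{A}$ and does not stop on any other input. Let $p_1=2,p_2=3,\dots$ be the prime numbers in increasing order, let $\mathcal{K}\in\mathsf{M}_{\rm add}^1$ be a machine that semi-decides $\bigcup_{i\ge 1}\{i\}\times(\mathbb{R}\setminus\{\sqrt{p_i}\})$ (such machines exist), and let ${\rm code}(\mathcal{K})\in\{0,1\}^\infty$ be the code of its program, in which each symbol of the program is unambiguously encoded by $b$ zeros and ones, for some fixed $b$. For $i\ge 1$ let $$\mathbb{P}_i=\{(2\,.\,(i,x)\,.\,{\rm code}(\mathcal{K})) \mid x\in\mathbb{R}\setminus\{\sqrt{p_i}\}\}\subseteq\mathbb{R}^\infty,$$ where the dots denote concatenation of tuples. Then, for any $i,j\ge 1$ with $i\ne j$, $\mathbb{P}_i\not\preceq\mathbb{P}_j$ and $\mathbb{P}_j\not\preceq\mathbb{P}_i$. -/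

import Mathlib

open StateTransition

noncomputable section

namespace AddBSS

/-! ## The space of inputs -/

/-- `ℝ^∞ = ⋃_{n ≥ 1} ℝ^n`, the set of non-empty finite tuples of real numbers. -/
abbrev RInf : Type := {l : List ℝ // l ≠ []}

/-- The tuple of length one with entry `r`. -/
def RInf.single (r : ℝ) : RInf := ⟨[r], by simp⟩

/-- The length of a tuple, a positive integer. -/
def RInf.len (x : RInf) : ℕ+ := ⟨x.1.length, List.length_pos_iff.2 x.2⟩

/-! ## Machines -/

/-- A configuration of a machine: the label of the instruction to be executed next, the contents
of the registers `Z₁, Z₂, …` (real numbers), and the contents of the index registers `I₁, I₂, …`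
(positive integers). A program mentions only finitely many index registers; the contents of the
others are never read or changed. -/
structure Config where
  pc : ℕ
  Z : ℕ+ → ℝ
  I : ℕ+ → ℕ+

/-- The instructions of the additive machines over `(ℝ; 0, 1; +, -; ≥)`. -/
inductive Instr where
  /-- `Z_i := Z_j + Z_k` -/
  | plus (i j k : ℕ+)
  /-- `Z_i := Z_j - Z_k` -/
  | minus (i j k : ℕ+)
  /-- `Z_j := 0` -/
  | zero (j : ℕ+)
  /-- `Z_j := 1` -/
  | one (j : ℕ+)
  /-- if `Z_j ≥ 0` then goto `l₁` else goto `l₂` -/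
  | ifGe (j : ℕ+) (l₁ l₂ : ℕ)
  /-- `Z_{I_j} := Z_{I_k}` -/
  | copy (j k : ℕ+)
  /-- `I_j := 1` -/
  | idxOne (j : ℕ+)
  /-- `I_j := I_j + 1` -/
  | idxSucc (j : ℕ+)
  /-- if `I_j = I_k` then goto `l₁` else goto `l₂` -/
  | idxEq (j k : ℕ+) (l₁ l₂ : ℕ)

/-- The instructions of the oracle machines: additionally
"if `(Z_1, …, Z_{I_1}) ∈ 𝒪` then goto `l₁` else goto `l₂`". -/
inductive OracleInstr where
  | basic (c : Instr)
  | query (l₁ l₂ : ℕ)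

/-- The tuple `(Z_1, …, Z_{I_1})`. -/
def Config.tuple (c : Config) : RInf :=
  ⟨(List.range (c.I 1 : ℕ)).map fun m => c.Z m.succPNat, by simp⟩

/-- The effect of one instruction on a configuration. -/
def Instr.exec : Instr → Config → Config
  | .plus i j k, c => ⟨c.pc + 1, Function.update c.Z i (c.Z j + c.Z k), c.I⟩
  | .minus i j k, c => ⟨c.pc + 1, Function.update c.Z i (c.Z j - c.Z k), c.I⟩
  | .zero j, c => ⟨c.pc + 1, Function.update c.Z j 0, c.I⟩
  | .one j, c => ⟨c.pc + 1, Function.update c.Z j 1, c.I⟩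
  | .ifGe j l₁ l₂, c => ⟨if 0 ≤ c.Z j then l₁ else l₂, c.Z, c.I⟩
  | .copy j k, c => ⟨c.pc + 1, Function.update c.Z (c.I j) (c.Z (c.I k)), c.I⟩
  | .idxOne j, c => ⟨c.pc + 1, c.Z, Function.update c.I j 1⟩
  | .idxSucc j, c => ⟨c.pc + 1, c.Z, Function.update c.I j (c.I j + 1)⟩
  | .idxEq j k l₁ l₂, c => ⟨if c.I j = c.I k then l₁ else l₂, c.Z, c.I⟩

open scoped Classical in
/-- The effect of one instruction of an oracle machine with oracle `O`. -/
def OracleInstr.exec (O : Set RInf) : OracleInstr → Config → Config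
  | .basic i, c => i.exec c
  | .query l₁ l₂, c => ⟨if c.tuple ∈ O then l₁ else l₂, c.Z, c.I⟩

/-- A machine in `M_add^1`: a program, that is, a finite sequence of instructions with the labels
`0, 1, …, N - 1`. Every label `≥ N` is the label of the stop instruction. -/
abbrev Machine : Type := List Instr

/-- An oracle machine. It is a machine in `M_add^1(O)` when it is run with the oracle `O`. -/
abbrev OracleMachine : Type := List OracleInstr

/-- One step of a program, where `exec` is the effect of a single instruction; `none` if the
program has reached the stop instruction. -/
def step {ι : Type} (exec : ι → Config → Config) (P : List ι) (c : Config) : Option Config :=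
  (P[c.pc]?).map fun i => exec i c

/-- The input procedure `Z_1 := x_1; …; Z_n := x_n; I_1 := n; …; I_k := n`; all other registers
contain `0`. -/
def init (x : RInf) : Config :=
  ⟨0, fun m => x.1.getD m.natPred 0, fun _ => x.len⟩

/-- The partial function computed by a program: the output is the tuple `(Z_1, …, Z_{I_1})` if the
program stops, and it is undefined otherwise. -/
def compute {ι : Type} (exec : ι → Config → Config) (P : List ι) (x : RInf) : Part RInf :=
  (eval (step exec P) (init x)).map Config.tuple

/-- The machine `M` semi-decides the problem `A`: it computes the partial characteristic function
of `A`. -/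
def Machine.SemiDecides (M : Machine) (A : Set RInf) : Prop :=
  ∀ x : RInf,
    (x ∈ A → compute Instr.exec M x = Part.some (RInf.single 1)) ∧
    (x ∉ A → compute Instr.exec M x = Part.none)

/-- The oracle machine `M` with oracle `O` decides the problem `A`: it computes the characteristic
function of `A`. -/
def OracleMachine.Decides (M : OracleMachine) (O A : Set RInf) : Prop :=
  ∀ x : RInf,
    (x ∈ A → compute (OracleInstr.exec O) M x = Part.some (RInf.single 1)) ∧
    (x ∉ A → compute (OracleInstr.exec O) M x = Part.some (RInf.single 0))

/-- The strong Turing reduction `A ≼ B` by additive machines whose only constants are `0`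
and `1`. -/
def Reducible (A B : Set RInf) : Prop :=
  ∃ M : OracleMachine, M.Decides B A

infix:50 " ≼ " => Reducible

/-! ## Codes of machines -/

/-- The symbols used to write programs:
`Z`, `I`, `:=`, `+`, `-`, the digits `0` and `1`, `if`, `≥`, `=`, `then goto`, `else goto`, and the
semicolon that ends an instruction. -/
inductive Sym where
  | Z | I | assign | plus | minus | bit0 | bit1 | cond | ge | eq | thenGoto | elseGoto | semi

/-- The binary digits of a natural number, least significant digit first. -/
def num (n : ℕ) : List Sym := n.bits.map fun b => bif b then .bit1 else .bit0

/-- An instruction as a word; the label of an instruction is its position in the program. -/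
def Instr.text : Instr → List Sym
  | .plus i j k => .Z :: num i ++ .assign :: .Z :: num j ++ .plus :: .Z :: num k ++ [.semi]
  | .minus i j k => .Z :: num i ++ .assign :: .Z :: num j ++ .minus :: .Z :: num k ++ [.semi]
  | .zero j => .Z :: num j ++ [.assign, .bit0, .semi]
  | .one j => .Z :: num j ++ [.assign, .bit1, .semi]
  | .ifGe j l₁ l₂ =>
      .cond :: .Z :: num j ++ .ge :: .bit0 :: .thenGoto :: num l₁ ++ .elseGoto :: num l₂ ++ [.semi]
  | .copy j k => .Z :: .I :: num j ++ .assign :: .Z :: .I :: num k ++ [.semi]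
  | .idxOne j => .I :: num j ++ [.assign, .bit1, .semi]
  | .idxSucc j => .I :: num j ++ .assign :: .I :: num j ++ [.plus, .bit1, .semi]
  | .idxEq j k l₁ l₂ =>
      .cond :: .I :: num j ++ .eq :: .I :: num k ++ .thenGoto :: num l₁ ++ .elseGoto :: num l₂
        ++ [.semi]

/-- A program as a word. -/
def Machine.text (M : Machine) : List Sym := List.flatMap Instr.text M

/-- The code of a machine in `{0, 1}^∞`, where every symbol of the program is encoded by a word of
length `b` over `{0, 1}` according to `e`. -/
def Machine.code {b : ℕ} (e : Sym → Fin b → Bool) (M : Machine) : List ℝ :=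
  M.text.flatMap fun s => List.ofFn fun t => if e s t then (1 : ℝ) else 0

/-! ## The problems -/

/-- The `i`-th prime number `p_i`, for `i ≥ 1`: `p_1 = 2`, `p_2 = 3`, … -/
def prime (i : ℕ) : ℕ := Nat.nth Nat.Prime (i - 1)

/-- The problem `⋃_{i ≥ 1} {i} × (ℝ ∖ {√p_i})`. -/
def sqrtProblem : Set RInf :=
  {z | ∃ i : ℕ, 1 ≤ i ∧ ∃ x : ℝ, x ≠ √(prime i : ℝ) ∧ z.1 = [(i : ℝ), x]}

/-- The problem `ℙ_i = {(2 . (i, x) . code(K)) | x ∈ ℝ ∖ {√p_i}}`. -/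
def primeProblem {b : ℕ} (e : Sym → Fin b → Bool) (K : Machine) (i : ℕ) : Set RInf :=
  {z | ∃ x : ℝ, x ≠ √(prime i : ℝ) ∧ z.1 = [2, (i : ℝ), x] ++ K.code e}

/-! ## Codes are unambiguous -/

/-- The digits `0` and `1`. -/
def Sym.isDigit : Sym → Bool
  | .bit0 | .bit1 => true
  | _ => false

theorem num_injective : Function.Injective num := by
  intro a c h
  have hf : Function.Injective (fun b : Bool => bif b then Sym.bit1 else Sym.bit0) := by
    intro x y; cases x <;> cases y <;> simp
  have h2 := List.map_injective_iff.2 hf h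
  apply Nat.digits.injective 2
  rw [Nat.digits_two_eq_bits, Nat.digits_two_eq_bits]
  exact congrArg _ h2

theorem num_isDigit (n : ℕ) : ∀ s ∈ num n, s.isDigit = true := by
  intro s hs
  obtain ⟨b, -, rfl⟩ := List.mem_map.1 hs
  cases b <;> rfl

theorem append_inj_digits {u v : List Sym} (hu : ∀ s ∈ u, s.isDigit = true)
    (hv : ∀ s ∈ v, s.isDigit = true) {s t : Sym} (hs : s.isDigit = false) (ht : t.isDigit = false)
    {l m : List Sym} (h : u ++ s :: l = v ++ t :: m) : u = v ∧ s = t ∧ l = m := by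
  induction u generalizing v with
  | nil =>
    cases v with
    | nil => simpa using h
    | cons x v => simp at h; simp [← h.1, hs] at hv
  | cons y u ih =>
    cases v with
    | nil => simp at h; simp [h.1, ht] at hu
    | cons x v =>
      simp at h hu hv
      obtain ⟨h1, h2⟩ := h
      have := ih hu.2 hv.2 h2
      simp [h1, this]

theorem num_append_inj {a c : ℕ} {s t : Sym} (hs : s.isDigit = false) (ht : t.isDigit = false)
    {l m : List Sym} (h : num a ++ s :: l = num c ++ t :: m) : a = c ∧ s = t ∧ l = m := by
  obtain ⟨h1, h2⟩ := append_inj_digits (num_isDigit a) (num_isDigit c) hs ht h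
  exact ⟨num_injective h1, h2⟩

theorem num_append_ne {a : ℕ} {s : Sym} (hs : s.isDigit = false) (hI : s ≠ .I)
    {l m : List Sym} : num a ++ s :: l ≠ .I :: m := by
  intro h
  exact hI (num_append_inj (a := a) (c := 0) hs rfl (by simpa [num] using h)).2.1

theorem text_append_inj (c d : Instr) (l m : List Sym) (h : c.text ++ l = d.text ++ m) :
    c = d ∧ l = m := by
  cases c <;> cases d <;>
    simp [Instr.text] at h ⊢ <;>
    (repeat (obtain ⟨h1, h2, h⟩ := num_append_inj rfl rfl h; simp at h1 h2 h)) <;>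
    first
    | simp_all
    | exact absurd h (num_append_ne rfl (by simp))
    | exact absurd h.symm (num_append_ne rfl (by simp))

theorem text_injective : Function.Injective Machine.text := by
  intro M N h
  induction M generalizing N with
  | nil =>
    cases N with
    | nil => rfl
    | cons d N => cases d <;> simp [Machine.text, Instr.text] at h
  | cons c M ih =>
    cases N with
    | nil => cases c <;> simp [Machine.text, Instr.text] at h
    | cons d N =>
      obtain ⟨h1, h2⟩ := text_append_inj c d (Machine.text M) (Machine.text N)
        (by simpa [Machine.text] using h)
      rw [h1, ih h2]

/-- Different machines have different codes. -/
theorem code_injective {b : ℕ} {e : Sym → Fin b → Bool} (he : Function.Injective e) :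
    Function.Injective (Machine.code e) := by
  have key : ∀ u v : List Sym,
      u.flatMap (fun s => List.ofFn fun t => if e s t then (1 : ℝ) else 0) =
      v.flatMap (fun s => List.ofFn fun t => if e s t then (1 : ℝ) else 0) → u = v := by
    have hb : b ≠ 0 := by
      rintro rfl
      exact absurd (@he .Z .I (Subsingleton.elim _ _)) (by simp)
    intro u
    induction u with
    | nil =>
      intro v h
      cases v with
      | nil => rfl
      | cons t v => simp [hb] at h
    | cons s u ih =>
      intro v h
      cases v with
      | nil => simp [hb] at h
      | cons t v =>
        simp only [List.flatMap_cons] at h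
        obtain ⟨h1, h2⟩ := List.append_inj h (by simp)
        have h3 := List.ofFn_injective h1
        have : s = t := he (by
          funext k
          have := congrFun h3 k
          cases h : e s k <;> cases h' : e t k <;> simp_all)
        rw [this, ih v h2]
  intro M N h
  exact text_injective (key _ _ h)

/-! ## A machine that semi-decides the problem `⋃_{i ≥ 1} {i} × (ℝ ∖ {√p_i})` -/

namespace Existence

/-- A machine for `⋃_{i ≥ 1} {i} × (ℝ ∖ {√p_i})`. On input `(i, x)` it looks for the prime `p = p_i`
by trial division (`Z_4` is the candidate, `Z_1` counts down), and then, for `q = 1, 2, …`, it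
computes `Z_8 = q x`, `Z_9 = p q²` and the least natural number `Z_11 = r` with `r² ≥ p q²`, and
accepts if `q x > r` or `q x < r - 1`. -/
def machineK : Machine := [
  .idxOne 2, .idxSucc 2, .idxEq 1 2 4 3, .idxEq 1 1 3 3,
  .one 3, .one 4,
  .plus 4 4 3, .one 5,
  .plus 5 5 3, .zero 6,
  .minus 7 6 4, .ifGe 7 14 12, .plus 6 6 5, .idxEq 1 1 10 10,
  .minus 7 4 6, .ifGe 7 16 8,
  .minus 7 5 4, .ifGe 7 18 6,
  .minus 1 1 3, .ifGe 1 20 6, .zero 7, .minus 7 7 1, .ifGe 7 23 6,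
  .plus 10 4 8,
  .plus 8 8 2, .plus 9 9 10, .plus 10 10 4, .plus 10 10 4,
  .minus 7 12 9, .ifGe 7 34 30, .plus 12 12 11, .plus 11 11 3, .plus 12 12 11, .idxEq 1 1 28 28,
  .minus 7 11 8, .ifGe 7 36 39, .minus 7 8 11, .plus 7 7 3, .ifGe 7 24 39,
  .idxOne 1, .one 1]

abbrev stepK : Config → Option Config := step Instr.exec machineK

theorem not_halt {f : Config → Option Config} (A : Config → Prop)
    (hA : ∀ c, A c → ∃ c', Reaches₁ f c c' ∧ A c') {c : Config} (hc : A c) :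
    eval f c = Part.none := by
  rw [Part.eq_none_iff]
  intro b hb
  have key : ∀ a, Reaches f c a → ∃ c', Reaches₁ f a c' ∧ A c' := by
    intro a ha
    induction ha with
    | refl => exact hA c hc
    | tail _ h ih =>
      obtain ⟨c', h1, h2⟩ := ih
      obtain ⟨c'', h3, h4⟩ := hA c' h2
      exact ⟨c'', Relation.TransGen.trans_right (reaches₁_fwd h1 h) h3, h4⟩
  obtain ⟨c', h1, -⟩ := key b (mem_eval.1 hb).1
  exact eval_maximal₁ hb _ h1

/-- The configuration after `k` steps. -/
def runN : ℕ → Config → Option Config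
  | 0, c => some c
  | k + 1, c => (stepK c).bind (runN k)

theorem reaches_of_runN (k : ℕ) {c c' : Config} (h : runN (k + 1) c = some c') :
    Reaches₁ stepK c c' := by
  induction k generalizing c with
  | zero =>
    simp only [runN, Option.bind_eq_some_iff] at h
    obtain ⟨a, h1, h2⟩ := h
    cases h2
    exact .single h1
  | succ k ih =>
    rw [runN, Option.bind_eq_some_iff] at h
    obtain ⟨a, h1, h2⟩ := h
    exact (ih h2).head h1

/-- The contents of the registers used by `machineK`. -/
structure St (pc : ℕ) (C x n d m X T D r R : ℝ) (c : Config) : Prop where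
  pc : c.pc = pc
  z1 : c.Z 1 = C
  z2 : c.Z 2 = x
  z3 : c.Z 3 = 1
  z4 : c.Z 4 = n
  z5 : c.Z 5 = d
  z6 : c.Z 6 = m
  z8 : c.Z 8 = X
  z9 : c.Z 9 = T
  z10 : c.Z 10 = D
  z11 : c.Z 11 = r
  z12 : c.Z 12 = R

variable {C x n d m X T D r R : ℝ} {c : Config}

theorem L6 (h : St 6 C x n d m X T D r R c) :
    ∃ c', Reaches₁ stepK c c' ∧ St 8 C x (n + 1) 1 m X T D r R c' := by
  obtain ⟨pc, Z, I⟩ := c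
  obtain ⟨h0, h1, h2, h3, h4, h5, h6, h8, h9, h10, h11, h12⟩ := h
  dsimp only at *
  subst h0
  refine ⟨_, reaches_of_runN 1 (by simp [runN, step, machineK, Instr.exec]; rfl), ?_⟩
  constructor <;> simp [*]

theorem L8 (h : St 8 C x n d m X T D r R c) :
    ∃ c', Reaches₁ stepK c c' ∧ St 10 C x n (d + 1) 0 X T D r R c' := by
  obtain ⟨pc, Z, I⟩ := c
  obtain ⟨h0, h1, h2, h3, h4, h5, h6, h8, h9, h10, h11, h12⟩ := h
  dsimp only at *
  subst h0
  refine ⟨_, reaches_of_runN 1 (by simp [runN, step, machineK, Instr.exec]; rfl), ?_⟩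
  constructor <;> simp [*]

theorem L10lt (h : St 10 C x n d m X T D r R c) (hm : m < n) :
    ∃ c', Reaches₁ stepK c c' ∧ St 10 C x n d (m + d) X T D r R c' := by
  obtain ⟨pc, Z, I⟩ := c
  obtain ⟨h0, h1, h2, h3, h4, h5, h6, h8, h9, h10, h11, h12⟩ := h
  dsimp only at *
  subst h0
  refine ⟨_, reaches_of_runN 3
    (by simp [runN, step, machineK, Instr.exec, h4, h6, not_le.2 hm]; rfl), ?_⟩
  constructor <;> simp [*]

theorem L10gt (h : St 10 C x n d m X T D r R c) (hm : n < m) :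
    ∃ c', Reaches₁ stepK c c' ∧ St 8 C x n d m X T D r R c' := by
  obtain ⟨pc, Z, I⟩ := c
  obtain ⟨h0, h1, h2, h3, h4, h5, h6, h8, h9, h10, h11, h12⟩ := h
  dsimp only at *
  subst h0
  refine ⟨_, reaches_of_runN 3
    (by simp [runN, step, machineK, Instr.exec, h4, h6, not_le.2 hm, hm.le]; rfl), ?_⟩
  constructor <;> simp [*]

theorem L10comp (h : St 10 C x n d m X T D r R c) (hm : m = n) (hd : d < n) :
    ∃ c', Reaches₁ stepK c c' ∧ St 6 C x n d m X T D r R c' := by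
  obtain ⟨pc, Z, I⟩ := c
  obtain ⟨h0, h1, h2, h3, h4, h5, h6, h8, h9, h10, h11, h12⟩ := h
  dsimp only at *
  subst h0
  refine ⟨_, reaches_of_runN 5
    (by simp [runN, step, machineK, Instr.exec, h4, h5, h6, hm, not_le.2 hd]; rfl), ?_⟩
  constructor <;> simp [*]

theorem L10prime (h : St 10 C x n d m X T D r R c) (hm : m = n) (hd : n ≤ d) (hC : C ≠ 1) :
    ∃ c', Reaches₁ stepK c c' ∧ St 6 (C - 1) x n d m X T D r R c' := by
  obtain ⟨pc, Z, I⟩ := c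
  obtain ⟨h0, h1, h2, h3, h4, h5, h6, h8, h9, h10, h11, h12⟩ := h
  dsimp only at *
  subst h0
  rcases lt_or_gt_of_ne hC with hC | hC
  · refine ⟨_, reaches_of_runN 7
      (by simp [runN, step, machineK, Instr.exec, h1, h3, h4, h5, h6, hm, hd, not_le.2 hC]; rfl), ?_⟩
    constructor <;> simp [*]
  · refine ⟨_, reaches_of_runN 10
      (by simp [runN, step, machineK, Instr.exec, h1, h3, h4, h5, h6, hm, hd, hC.le, not_le.2 hC]
          rfl), ?_⟩
    constructor <;> simp [*]

theorem L10go (h : St 10 1 x n d m 0 T D r R c) (hm : m = n) (hd : n ≤ d) :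
    ∃ c', Reaches₁ stepK c c' ∧ St 24 0 x n d m 0 T n r R c' := by
  obtain ⟨pc, Z, I⟩ := c
  obtain ⟨h0, h1, h2, h3, h4, h5, h6, h8, h9, h10, h11, h12⟩ := h
  dsimp only at *
  subst h0
  refine ⟨_, reaches_of_runN 11
      (by simp [runN, step, machineK, Instr.exec, h1, h3, h4, h5, h6, hm, hd]; rfl), ?_⟩
  constructor <;> simp [*]

theorem L24 (h : St 24 C x n d m X T D r R c) :
    ∃ c', Reaches₁ stepK c c' ∧ St 28 C x n d m (X + x) (T + D) (D + n + n) r R c' := by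
  obtain ⟨pc, Z, I⟩ := c
  obtain ⟨h0, h1, h2, h3, h4, h5, h6, h8, h9, h10, h11, h12⟩ := h
  dsimp only at *
  subst h0
  refine ⟨_, reaches_of_runN 3 (by simp [runN, step, machineK, Instr.exec]; rfl), ?_⟩
  constructor <;> simp [*]

theorem L28lt (h : St 28 C x n d m X T D r R c) (hR : R < T) :
    ∃ c', Reaches₁ stepK c c' ∧ St 28 C x n d m X T D (r + 1) (R + r + (r + 1)) c' := by
  obtain ⟨pc, Z, I⟩ := c
  obtain ⟨h0, h1, h2, h3, h4, h5, h6, h8, h9, h10, h11, h12⟩ := h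
  dsimp only at *
  subst h0
  refine ⟨_, reaches_of_runN 5
    (by simp [runN, step, machineK, Instr.exec, h12, h9, not_le.2 hR]; rfl), ?_⟩
  constructor <;> simp [*]

theorem L28no (h : St 28 C x n d m X T D r R c) (hR : T ≤ R) (h1X : X ≤ r) (h2X : r ≤ X + 1) :
    ∃ c', Reaches₁ stepK c c' ∧ St 24 C x n d m X T D r R c' := by
  obtain ⟨pc, Z, I⟩ := c
  obtain ⟨h0, h1, h2, h3, h4, h5, h6, h8, h9, h10, h11, h12⟩ := h
  dsimp only at *
  subst h0
  have : 0 ≤ X - r + 1 := by linarith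
  refine ⟨_, reaches_of_runN 6
    (by simp [runN, step, machineK, Instr.exec, h3, h12, h9, h8, h11, hR, h1X, this]; rfl), ?_⟩
  constructor <;> simp [*]

theorem L28yes (h : St 28 C x n d m X T D r R c) (hR : T ≤ R) (hX : r < X ∨ X + 1 < r) :
    (eval stepK c).map Config.tuple = Part.some (RInf.single 1) := by
  obtain ⟨pc, Z, I⟩ := c
  obtain ⟨h0, h1, h2, h3, h4, h5, h6, h8, h9, h10, h11, h12⟩ := h
  dsimp only at *
  subst h0
  have fin : ∀ (Z' : ℕ+ → ℝ), (∃ k, runN (k + 1) ⟨28, Z, I⟩ = some ⟨39, Z', I⟩) →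
    (eval stepK ⟨28, Z, I⟩).map Config.tuple = Part.some (RInf.single 1) := by
    rintro Z' ⟨k, hk⟩
    have r1 := reaches_of_runN k hk
    have r2 : Reaches₁ stepK ⟨39, Z', I⟩ ⟨41, Function.update Z' 1 1, Function.update I 1 1⟩ :=
      reaches_of_runN 1 (by simp [runN, step, machineK, Instr.exec])
    have := mem_eval.2 ⟨(r1.trans r2).to_reflTransGen, show stepK _ = none by
      simp [step, machineK]⟩
    rw [Part.eq_some_iff.2 this, Part.map_some]
    congr 1
  by_cases hr : r < X
  · exact fin _ ⟨3, by
      simp [runN, step, machineK, Instr.exec, h12, h9, h8, h11, hR, not_le.2 hr]; rfl⟩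
  · have hX : ¬ 0 ≤ X - r + 1 := by rcases hX with h | h; exact absurd h hr; linarith
    exact fin _ ⟨6, by
      simp [runN, step, machineK, Instr.exec, h3, h12, h9, h8, h11, hR, not_lt.1 hr, hX]; rfl⟩


theorem multiples {N k : ℕ} (hk : 1 ≤ k) : ∀ (s M : ℕ) (c : Config), N - M ≤ s → k ∣ M → M < N + k →
    St 10 C x N k M X T D r R c →
    ∃ M' c', Reaches stepK c c' ∧ k ∣ M' ∧ N ≤ M' ∧ M' < N + k ∧ St 10 C x N k M' X T D r R c' := by
  intro s
  induction s with
  | zero =>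
    intro M c hs hM hM' h
    exact ⟨M, c, .refl, hM, by omega, hM', h⟩
  | succ s ih =>
    intro M c hs hM hM' h
    by_cases hlt : M < N
    · obtain ⟨c1, r1, h1⟩ := L10lt h (by exact_mod_cast hlt)
      obtain ⟨M', c2, r2, h2⟩ := ih (M + k) c1 (by omega) (Nat.dvd_add hM dvd_rfl) (by omega)
        (by exact_mod_cast h1)
      exact ⟨M', c2, r1.to_reflTransGen.trans r2, h2⟩
    · exact ⟨M, c, .refl, hM, by omega, hM', h⟩

theorem findDiv {N : ℕ} (hN : 2 ≤ N) : ∀ (s k : ℕ) (m : ℝ) (c : Config), N.minFac - k ≤ s →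
    1 ≤ k → k < N.minFac → St 8 C x N k m X T D r R c →
    ∃ c', Reaches₁ stepK c c' ∧ St 10 C x N N.minFac N X T D r R c' := by
  intro s
  induction s with
  | zero => intros; omega
  | succ s ih =>
    intro k m c hs hk hlt h
    obtain ⟨c1, r1, h1⟩ := L8 h
    obtain ⟨M, c2, r2, hM, hM1, hM2, h2⟩ := multiples (N := N) (k := k + 1) (by omega) N 0 c1
      (by omega) (by simp) (by omega) (by exact_mod_cast h1)
    have r12 := Relation.TransGen.trans_left r1 r2
    have hd : M = N ↔ k + 1 ∣ N := by
      constructor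
      · rintro rfl; exact hM
      · intro hd
        by_contra hne
        have := Nat.le_of_dvd (by omega) (Nat.dvd_sub hM hd)
        omega
    by_cases hk1 : k + 1 = N.minFac
    · have := hd.2 (hk1 ▸ N.minFac_dvd)
      subst this
      exact ⟨c2, r12, by rwa [hk1] at h2⟩
    · have hne : M ≠ N := fun h => by
        have := Nat.minFac_le_of_dvd (by omega) (hd.1 h)
        omega
      obtain ⟨c3, r3, h3⟩ := L10gt h2 (by exact_mod_cast (by omega : N < M))
      obtain ⟨c4, r4, h4⟩ := ih (k + 1) _ c3 (by omega) (by omega) (by omega) h3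
      exact ⟨c4, (r12.trans r3).trans r4, h4⟩

theorem toPrime {N : ℕ} (hN : 1 ≤ N) (h : St 6 C x N d m X T D r R c) :
    ∃ c', Reaches₁ stepK c c' ∧ St 10 C x (N + 1 : ℕ) (N + 1).minFac (N + 1 : ℕ) X T D r R c' := by
  obtain ⟨c1, r1, h1⟩ := L6 h
  obtain ⟨c2, r2, h2⟩ := findDiv (N := N + 1) (by omega) (N + 1).minFac 1 m c1 (by omega) le_rfl
    (by have := (Nat.minFac_prime (n := N + 1) (by omega)).two_le; omega) (by exact_mod_cast h1)
  exact ⟨c2, r1.trans r2, h2⟩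

/-- The head of the loop that searches for the prime. -/
def A (y x : ℝ) (N : ℕ) (c : Config) : Prop :=
  1 ≤ N ∧ ∃ d m, St 6 (y - Nat.count Nat.Prime (N + 1)) x N d m 0 0 0 0 0 c

theorem A_next {y x : ℝ} {N : ℕ} {c : Config} (h : A y x N c)
    (hy : ¬ ((N + 1).Prime ∧ y - Nat.count Nat.Prime (N + 1) = 1)) :
    ∃ c', Reaches₁ stepK c c' ∧ A y x (N + 1) c' := by
  obtain ⟨hN, d, m, h⟩ := h
  obtain ⟨c1, r1, h1⟩ := toPrime hN h
  by_cases hp : (N + 1).Prime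
  · obtain ⟨c2, r2, h2⟩ := L10prime h1 rfl
      (by exact_mod_cast (Nat.prime_def_minFac.1 hp).2.ge) (fun h => hy ⟨hp, h⟩)
    refine ⟨c2, r1.trans r2, by omega, (N + 1).minFac, (N + 1 : ℕ), ?_⟩
    convert h2 using 1
    rw [Nat.count_succ, if_pos hp]
    push_cast
    ring
  · obtain ⟨c2, r2, h2⟩ := L10comp h1 rfl
      (by exact_mod_cast (Nat.not_prime_iff_minFac_lt (by omega)).1 hp)
    refine ⟨c2, r1.trans r2, by omega, (N + 1).minFac, (N + 1 : ℕ), ?_⟩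
    convert h2 using 1
    rw [Nat.count_succ, if_neg hp]
    simp

theorem A_go {y x : ℝ} {N : ℕ} {c : Config} (h : A y x N c)
    (hp : (N + 1).Prime) (hy : y - Nat.count Nat.Prime (N + 1) = 1) :
    ∃ c' d m, Reaches₁ stepK c c' ∧ St 24 0 x (N + 1 : ℕ) d m 0 0 (N + 1 : ℕ) 0 0 c' := by
  obtain ⟨hN, d, m, h⟩ := h
  obtain ⟨c1, r1, h1⟩ := toPrime hN h
  rw [hy] at h1
  obtain ⟨c2, r2, h2⟩ := L10go h1 rfl (by exact_mod_cast (Nat.prime_def_minFac.1 hp).2.ge)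
  exact ⟨c2, _, _, r1.trans r2, h2⟩

/-- The head of the loop that compares `x` with `√p`. -/
def B (x : ℝ) (p q : ℕ) (c : Config) : Prop :=
  ∃ (d m : ℝ) (k : ℕ), (k = 0 ∨ ((k : ℝ) - 1) ^ 2 < p * q ^ 2) ∧
    St 24 0 x p d m (q * x) (p * q ^ 2) (p * (2 * q + 1)) k (k ^ 2) c

theorem B_inner {n d m X D : ℝ} {T : ℕ} : ∀ (s k : ℕ) (c : Config), T - k ≤ s →
    (k = 0 ∨ ((k : ℝ) - 1) ^ 2 < T) → St 28 C x n d m X T D k (k ^ 2) c →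
    ∃ (k' : ℕ) (c' : Config), Reaches stepK c c' ∧ (k' = 0 ∨ ((k' : ℝ) - 1) ^ 2 < T) ∧
      (T : ℝ) ≤ k' ^ 2 ∧ St 28 C x n d m X T D k' (k' ^ 2) c' := by
  intro s
  induction s with
  | zero =>
    intro k c hs hk h
    refine ⟨k, c, .refl, hk, ?_, h⟩
    have : T ≤ k ^ 2 := by nlinarith [(by omega : T ≤ k), Nat.le_self_pow (n := 2) (by omega) k]
    exact_mod_cast this
  | succ s ih =>
    intro k c hs hk h
    by_cases hlt : ((k : ℝ)) ^ 2 < T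
    · obtain ⟨c1, r1, h1⟩ := L28lt h hlt
      have hlt' : k ^ 2 < T := by exact_mod_cast hlt
      obtain ⟨k', c2, r2, h2⟩ := ih (k + 1) c1
        (by have := Nat.le_self_pow (n := 2) (by omega) k; omega)
        (Or.inr (by push_cast; simpa using hlt))
        (by convert h1 using 1 <;> push_cast <;> ring)
      exact ⟨k', c2, r1.to_reflTransGen.trans r2, h2⟩
    · exact ⟨k, c, .refl, hk, not_lt.1 hlt, h⟩

theorem B_next {x : ℝ} {p q : ℕ} (hp : 1 ≤ p) {c : Config} (h : B x p q c) :
    ∃ k : ℕ, 1 ≤ k ∧ (k : ℝ) - 1 < (q + 1) * √p ∧ (q + 1) * √p ≤ k ∧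
      (((q + 1) * x ≤ k ∧ (k : ℝ) ≤ (q + 1) * x + 1 →
          ∃ c', Reaches₁ stepK c c' ∧ B x p (q + 1) c') ∧
       ((k : ℝ) < (q + 1) * x ∨ (q + 1) * x + 1 < k →
          (eval stepK c).map Config.tuple = Part.some (RInf.single 1))) := by
  obtain ⟨d, m, k, hk, h⟩ := h
  obtain ⟨c1, r1, h1⟩ := L24 h
  have e : (p * q ^ 2 + p * (2 * q + 1) : ℝ) = (p * (q + 1) ^ 2 : ℕ) := by push_cast; ring
  have hp' : (1 : ℝ) ≤ p := by exact_mod_cast hp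
  have hk' : k = 0 ∨ ((k : ℝ) - 1) ^ 2 < (p * (q + 1) ^ 2 : ℕ) := by
    refine hk.imp_right fun h => h.trans ?_
    rw [← e]
    have : (0 : ℝ) ≤ q := Nat.cast_nonneg q
    nlinarith
  rw [e] at h1
  obtain ⟨k', c2, r2, hk1, hk2, h2⟩ := B_inner _ k c1 le_rfl hk' h1
  have r12 := Relation.TransGen.trans_left r1 r2
  have hs : ((q + 1) * √p) ^ 2 = ((p * (q + 1) ^ 2 : ℕ) : ℝ) := by
    rw [mul_pow, Real.sq_sqrt (Nat.cast_nonneg p)]; push_cast; ring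
  have hq : (0 : ℝ) < (q + 1) * √p := by
    have := Real.sqrt_pos.2 (by linarith : (0 : ℝ) < p)
    positivity
  have hk0 : k' ≠ 0 := by
    rintro rfl
    rw [← hs] at hk2
    have := pow_pos hq 2
    rw [Nat.cast_zero, zero_pow two_ne_zero] at hk2
    linarith
  have hk1 := hk1.resolve_left hk0
  rw [← hs] at hk1 hk2
  have eX : (q * x + x : ℝ) = (q + 1) * x := by ring
  rw [eX] at h2
  refine ⟨k', by omega, lt_of_pow_lt_pow_left₀ 2 hq.le hk1,
    le_of_sq_le_sq hk2 (Nat.cast_nonneg _), ?_, ?_⟩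
  · rintro ⟨hX1, hX2⟩
    obtain ⟨c3, r3, h3⟩ := L28no h2 (by rwa [← hs]) hX1 hX2
    refine ⟨c3, r12.trans r3, d, m, k', Or.inr ?_, ?_⟩
    · rw [hs] at hk1; exact_mod_cast hk1
    · convert h3 using 1 <;> push_cast <;> ring
  · intro hX
    rw [reaches_eval r12.to_reflTransGen]
    exact L28yes h2 (by rwa [← hs]) hX

theorem B_div {p q : ℕ} (hp : 1 ≤ p) {c : Config} (h : B (√p) p q c) :
    eval stepK c = Part.none := by
  refine not_halt (fun c => ∃ q, B (√p) p q c) ?_ ⟨q, h⟩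
  rintro c ⟨q, h⟩
  obtain ⟨k, -, h1, h2, h3, -⟩ := B_next hp h
  obtain ⟨c', r, h'⟩ := h3 ⟨h2, by linarith⟩
  exact ⟨c', r, _, h'⟩

theorem B_halt {p : ℕ} (hp : 1 ≤ p) {x : ℝ} (hx : x ≠ √p) : ∀ (s q : ℕ) (c : Config),
    1 < (q + s + 1) * |x - √p| → B x p q c →
    (eval stepK c).map Config.tuple = Part.some (RInf.single 1) := by
  intro s
  induction s with
  | zero =>
    intro q c hs h
    obtain ⟨k, -, h1, h2, -, h3⟩ := B_next hp h
    apply h3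
    rw [Nat.cast_zero, add_zero] at hs
    have hq : (0 : ℝ) < q + 1 := by positivity
    rcases lt_or_gt_of_ne hx with hx | hx
    · rw [abs_of_neg (by linarith)] at hs
      right; linarith
    · rw [abs_of_pos (by linarith)] at hs
      left; linarith
  | succ s ih =>
    intro q c hs h
    obtain ⟨k, -, h1, h2, h4, h3⟩ := B_next hp h
    by_cases hX : (q + 1) * x ≤ k ∧ (k : ℝ) ≤ (q + 1) * x + 1
    · obtain ⟨c', r, h'⟩ := h4 hX
      rw [reaches_eval r.to_reflTransGen]
      refine ih (q + 1) c' ?_ h'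
      push_cast at hs ⊢
      linarith
    · rw [not_and_or, not_le, not_le] at hX
      exact h3 hX

theorem start {y x : ℝ} : ∃ c', Reaches₁ stepK (init ⟨[y, x], by simp⟩) c' ∧ A y x 1 c' := by
  refine ⟨_, reaches_of_runN 4
    (by simp [runN, step, machineK, Instr.exec, init, RInf.len]; rfl), le_rfl, 0, 0, ?_⟩
  constructor <;> simp [Nat.count_succ, Nat.not_prime_zero, Nat.not_prime_one] <;> rfl

theorem A_reach {x : ℝ} {i : ℕ} (hi : 1 ≤ i) : ∀ (s N : ℕ) (c : Config), prime i - N ≤ s →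
    N < prime i → A i x N c → ∃ c', Reaches₁ stepK c c' ∧ B x (prime i) 0 c' := by
  have hcount : Nat.count Nat.Prime (prime i) = i - 1 :=
    Nat.count_nth_of_infinite Nat.infinite_setOfPred_prime _
  have hpr : (prime i).Prime := Nat.prime_nth_prime _
  intro s
  induction s with
  | zero => intros; omega
  | succ s ih =>
    intro N c hs hN h
    by_cases hN' : N + 1 = prime i
    · obtain ⟨c', d, m, r, h'⟩ := A_go h (hN' ▸ hpr) (by
        rw [hN', hcount, Nat.cast_sub hi]; simp)
      refine ⟨c', r, d, m, 0, Or.inl rfl, ?_⟩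
      rw [hN'] at h'
      simpa using h'
    · obtain ⟨c', r, h'⟩ := A_next h (by
        rintro ⟨hp, hy⟩
        apply hN'
        have : Nat.count Nat.Prime (N + 1) = i - 1 := by
          have : (Nat.count Nat.Prime (N + 1) : ℝ) + 1 = i := by linarith
          have : Nat.count Nat.Prime (N + 1) + 1 = i := by exact_mod_cast this
          omega
        have h2 := Nat.nth_count hp
        rw [this] at h2
        exact h2.symm)
      obtain ⟨c2, r2, h2⟩ := ih (N + 1) c' (by omega) (by omega) h'
      exact ⟨c2, r.trans r2, h2⟩

theorem A_div {y x : ℝ} (hy : ¬ ∃ i : ℕ, 1 ≤ i ∧ y = i) {N : ℕ} {c : Config} (h : A y x N c) :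
    eval stepK c = Part.none := by
  refine not_halt (fun c => ∃ N, A y x N c) ?_ ⟨N, h⟩
  rintro c ⟨N, h⟩
  obtain ⟨c', r, h'⟩ := A_next h (fun h => hy
    ⟨Nat.count Nat.Prime (N + 1) + 1, by omega, by push_cast; linarith [h.2]⟩)
  exact ⟨c', r, _, h'⟩

theorem len_div (z : RInf) (hz : z.1.length ≠ 2) : eval stepK (init z) = Part.none := by
  have hz' : z.len ≠ 2 := fun h => hz (congrArg PNat.val h)
  have r1 : ∃ c', Reaches₁ stepK (init z) c' ∧ c'.pc = 3 :=
    ⟨_, reaches_of_runN 2 (by simp [runN, step, machineK, Instr.exec, init]; rfl), by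
      simp; intro h; exact absurd h hz'⟩
  obtain ⟨c', r, h⟩ := r1
  rw [reaches_eval r.to_reflTransGen]
  refine not_halt (fun c => c.pc = 3) ?_ h
  rintro ⟨pc, Z, I⟩ h
  dsimp only at h
  subst h
  exact ⟨⟨3, Z, I⟩, reaches_of_runN 0 (by simp [runN, step, machineK, Instr.exec]), rfl⟩

theorem machineK_semiDecides : machineK.SemiDecides sqrtProblem := by
  have map_none : (Part.none : Part Config).map Config.tuple = Part.none := by simp
  intro z
  by_cases hz : z.1.length = 2
  · obtain ⟨z, hz0⟩ := z
    obtain ⟨y, x, rfl⟩ := List.length_eq_two.1 hz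
    obtain ⟨c, r, hA⟩ := start (y := y) (x := x)
    unfold compute
    change _ ∧ (_ → (eval stepK (init _)).map _ = _)
    by_cases hy : ∃ i : ℕ, 1 ≤ i ∧ y = i
    · obtain ⟨i, hi, rfl⟩ := hy
      have hpr : (prime i).Prime := Nat.prime_nth_prime _
      obtain ⟨c2, r2, hB⟩ := A_reach hi _ 1 c le_rfl hpr.one_lt hA
      constructor
      · rintro ⟨i', hi', x', hx', he⟩
        simp at he
        obtain ⟨rfl, rfl⟩ := he
        rw [reaches_eval (r.trans r2).to_reflTransGen]
        have hpos : 0 < |x - √(prime i)| := abs_pos.2 (sub_ne_zero.2 hx')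
        obtain ⟨s, hs⟩ := exists_nat_gt (1 / |x - √(prime i)|)
        rw [div_lt_iff₀ hpos] at hs
        exact B_halt hpr.one_lt.le hx' s 0 c2 (by push_cast; nlinarith) hB
      · intro hn
        have hx : x = √(prime i) := by
          by_contra hx
          exact hn ⟨i, hi, x, hx, rfl⟩
        subst hx
        rw [reaches_eval (r.trans r2).to_reflTransGen, B_div hpr.one_lt.le hB, map_none]
    · constructor
      · rintro ⟨i', hi', x', hx', he⟩
        simp at he
        exact absurd ⟨i', hi', he.1⟩ hy
      · intro _
        rw [reaches_eval r.to_reflTransGen, A_div hy hA, map_none]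
  · constructor
    · rintro ⟨i', hi', x', hx', he⟩
      exact absurd (by rw [he]; rfl) hz
    · intro _
      unfold compute
      change (eval stepK (init z)).map _ = _
      rw [len_div z hz, map_none]

end Existence

/-- There is a machine in `M_add^1` that semi-decides `⋃_{i ≥ 1} {i} × (ℝ ∖ {√p_i})`. -/
theorem exists_semiDecides_sqrtProblem : ∃ K : Machine, K.SemiDecides sqrtProblem :=
  ⟨_, Existence.machineK_semiDecides⟩

end AddBSS

end

namespace AddBSS

open Filter Topology

/-! Suppose an oracle machine decides ℙ_i with oracle ℙ_j. On the input (2, i, √p_i, code(K)), which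
is not in ℙ_i, it stops after finitely many steps with output 0. Without multiplication, and with 0
and 1 as the only constants, every register along this run contains an integer affine form a x + b
in the one variable entry x, evaluated at x = √p_i.

Because √p_i is irrational, such a form takes an integer value there only if it is constant
(`affineEval_eq_intCast_iff`). Hence each sign test has the same outcome for all x near √p_i. An
oracle query compares most entries of a tuple with integers, and these comparisons are locally
constant for the same reason. The one exception is the third entry, which is compared with √p_j; but
a√p_i + b = √p_j is impossible for integers a, b and distinct primes (`affineEval_sqrt_ne_sqrt`), so
the third entry stays away from √p_j near √p_i. Query answers are therefore locally constant too
(`eventually_mem_primeProblem_iff`).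

A finite run involves finitely many such tests, so all x close to √p_i follow the same path and stop
in the same affine configuration (`eventually_reaches`). The output is then 0 for some x ≠ √p_i as
well, although that input belongs to ℙ_i. -/

/-! ### Integer affine forms near an irrational point -/

/-- The value at `x` of the affine form `a X + b` with integer coefficients. -/
def affineEval (x : ℝ) (t : ℤ × ℤ) : ℝ := t.1 * x + t.2

theorem continuous_affineEval (t : ℤ × ℤ) : Continuous fun x => affineEval x t := by
  unfold affineEval
  fun_prop

/-- Configurations whose registers contain integer affine forms in one variable. -/
structure AffineConfig where
  pc : ℕ
  Z : ℕ+ → ℤ × ℤ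
  I : ℕ+ → ℕ+

/-- The configuration obtained by substituting `x` for the variable. -/
def AffineConfig.at (S : AffineConfig) (x : ℝ) : Config :=
  ⟨S.pc, fun m => affineEval x (S.Z m), S.I⟩

/-- If a ≠ 0, then a x₀ + b is irrational. So a borderline equality at x₀ holds identically in x,
which is what makes all tests stable under perturbation. -/
theorem affineEval_eq_intCast_iff {x₀ : ℝ} (hx : Irrational x₀) (t : ℤ × ℤ) (n : ℤ) :
    affineEval x₀ t = n ↔ t = (0, n) := by
  obtain ⟨a, b⟩ := t
  constructor
  · intro h
    by_cases ha : a = 0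
    · subst ha
      simp only [affineEval, Int.cast_zero, zero_mul, zero_add, Int.cast_inj] at h
      rw [h]
    · exact absurd h (((hx.intCast_mul ha).add_intCast b).ne_int n)
  · intro h
    cases h
    simp [affineEval]

/-- An inequality at x₀ persists by continuity; an equality persists because the form is then
constant. -/
theorem eventually_affineEval_eq_iff {x₀ : ℝ} (hx : Irrational x₀) (t : ℤ × ℤ) (n : ℤ) :
    ∀ᶠ x in 𝓝 x₀, affineEval x t = n ↔ affineEval x₀ t = n := by
  by_cases h : affineEval x₀ t = n
  · obtain rfl := (affineEval_eq_intCast_iff hx t n).1 h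
    simp [affineEval]
  · filter_upwards [(continuous_affineEval t).continuousAt.eventually_ne h] with x hx'
    simp [h, hx']

/-- Strict signs are open conditions, so only the value 0 is delicate, and it occurs only for the
zero form. -/
theorem eventually_nonneg_affineEval_iff {x₀ : ℝ} (hx : Irrational x₀) (t : ℤ × ℤ) :
    ∀ᶠ x in 𝓝 x₀, 0 ≤ affineEval x t ↔ 0 ≤ affineEval x₀ t := by
  have hc := (continuous_affineEval t).continuousAt (x := x₀)
  rcases lt_trichotomy (affineEval x₀ t) 0 with h | h | h
  · filter_upwards [hc.eventually_lt_const h] with x hx'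
    simp [not_le.2 h, not_le.2 hx']
  · obtain rfl := (affineEval_eq_intCast_iff hx t 0).1 (by simpa using h)
    simp [affineEval]
  · filter_upwards [hc.eventually_const_lt h] with x hx'
    simp [h.le, hx'.le]

/-- Used for two integer words: the 0-1 block `K.code e` at the end of a query, and the output word
`[0]`. -/
theorem eventually_map_affineEval_eq_iff {x₀ : ℝ} (hx : Irrational x₀) (l : List (ℤ × ℤ))
    (w : List ℝ) (hw : ∀ r ∈ w, ∃ n : ℤ, r = n) :
    ∀ᶠ x in 𝓝 x₀, l.map (affineEval x) = w ↔ l.map (affineEval x₀) = w := by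
  induction l generalizing w with
  | nil => simp
  | cons t l ih =>
    cases w with
    | nil => simp
    | cons r w =>
      obtain ⟨n, rfl⟩ := hw r (by simp)
      filter_upwards [ih w fun s hs => hw s (by simp [hs]),
        eventually_affineEval_eq_iff hx t n] with x h1 h2
      simp [h1, h2]

theorem Machine.code_isInt {b : ℕ} (e : Sym → Fin b → Bool) (M : Machine) :
    ∀ r ∈ M.code e, ∃ n : ℤ, r = n := by
  intro r hr
  simp only [Machine.code, List.mem_flatMap, List.mem_ofFn] at hr
  obtain ⟨s, -, t, rfl⟩ := hr
  split
  · exact ⟨1, by simp⟩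
  · exact ⟨0, by simp⟩

/-! ### Square roots of distinct primes -/

theorem prime_prime (i : ℕ) : (prime i).Prime := Nat.prime_nth_prime _

/-- The bounds matter: `prime` uses the truncated difference i - 1, so the indices 0 and 1 give the
same prime. -/
theorem prime_ne_prime {i j : ℕ} (hi : 1 ≤ i) (hj : 1 ≤ j) (hij : i ≠ j) :
    prime i ≠ prime j := by
  intro h
  have := Nat.nth_injective Nat.infinite_setOfPred_prime h
  omega

theorem irrational_sqrt_prime (i : ℕ) : Irrational √(prime i : ℝ) :=
  (prime_prime i).irrational_sqrt

/-- Squaring a√p + b = √q gives 2ab√p + (a²p + b²) = q, so ab = 0 by irrationality of √p. If a = 0,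
then √q would be an integer; if b = 0, then a²p = q, so p divides q and p = q. -/
theorem affineEval_sqrt_ne_sqrt {p q : ℕ} (hp : p.Prime) (hq : q.Prime) (hpq : p ≠ q)
    (t : ℤ × ℤ) : affineEval √(p : ℝ) t ≠ √(q : ℝ) := by
  obtain ⟨a, b⟩ := t
  intro h
  simp only [affineEval] at h
  have hps : √(p : ℝ) ^ 2 = p := Real.sq_sqrt (Nat.cast_nonneg p)
  have hqs : √(q : ℝ) ^ 2 = q := Real.sq_sqrt (Nat.cast_nonneg q)
  have hsq : (a : ℝ) ^ 2 * p + b ^ 2 + 2 * a * b * √(p : ℝ) = q := by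
    rw [← hqs, ← h, ← hps]
    ring_nf
    -- Rewriting p as √p² also acts under the root and leaves √(√p²), which is simplified here.
    rw [Real.sqrt_sq (Real.sqrt_nonneg _)]
  -- The squared relation is itself an integer affine form at √p with an integer value, so its slope
  -- 2ab must vanish.
  have ht : affineEval √(p : ℝ) (2 * a * b, a ^ 2 * p + b ^ 2) = (q : ℤ) := by
    simp only [affineEval]
    push_cast
    linarith
  rw [affineEval_eq_intCast_iff hp.irrational_sqrt, Prod.mk.injEq] at ht
  obtain ⟨h1, h2⟩ := ht
  have hab : a = 0 ∨ b = 0 := by simpa using h1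
  rcases hab with rfl | rfl
  · exact hq.irrational_sqrt.ne_int b (by simpa using h.symm)
  · have hd : (p : ℤ) ∣ q := ⟨a ^ 2, by linarith⟩
    exact hpq ((Nat.prime_dvd_prime_iff_eq hp hq).1 (Int.natCast_dvd_natCast.1 hd))

/-! ### Oracle queries near √p_i -/

variable {b : ℕ} (e : Sym → Fin b → Bool) (K : Machine)

theorem mem_primeProblem_iff (j : ℕ) (z : RInf) (t s r : ℝ) (l : List ℝ)
    (hz : z.1 = t :: s :: r :: l) :
    z ∈ primeProblem e K j ↔ t = 2 ∧ s = j ∧ r ≠ √(prime j : ℝ) ∧ l = K.code e := by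
  constructor
  · rintro ⟨y, hy, h⟩
    rw [hz] at h
    simp only [List.cons_append, List.nil_append, List.cons.injEq] at h
    obtain ⟨h1, h2, rfl, h4⟩ := h
    exact ⟨h1, h2, hy, h4⟩
  · rintro ⟨rfl, rfl, h3, rfl⟩
    exact ⟨r, h3, hz⟩

/-- Near `√p_i`, membership of a tuple of integer affine forms in `ℙ_j` does not depend on the
point. -/
theorem eventually_mem_primeProblem_iff {i j : ℕ} (hp : prime i ≠ prime j)
    (T : List (ℤ × ℤ)) (z : ℝ → RInf) (hz : ∀ x, (z x).1 = T.map (affineEval x)) :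
    ∀ᶠ x in 𝓝 √(prime i : ℝ), z x ∈ primeProblem e K j ↔ z √(prime i : ℝ) ∈ primeProblem e K j := by
  by_cases hT : ∃ t s r l, T = t :: s :: r :: l
  · obtain ⟨t, s, r, l, rfl⟩ := hT
    have hx := irrational_sqrt_prime i
    -- The condition on the third entry holds at √p_i, and being an open condition it holds nearby.
    have hr := affineEval_sqrt_ne_sqrt (prime_prime i) (prime_prime j) hp r
    filter_upwards [eventually_affineEval_eq_iff hx t 2, eventually_affineEval_eq_iff hx s j,
      (continuous_affineEval r).continuousAt.eventually_ne hr,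
      eventually_map_affineEval_eq_iff hx l _ (K.code_isInt e)] with x h1 h2 h3 h4
    rw [mem_primeProblem_iff e K j _ _ _ _ _ (hz x), mem_primeProblem_iff e K j _ _ _ _ _ (hz _)]
    push_cast at h1 h2
    rw [h1, h2, h4]
    simp only [ne_eq, h3, hr]
  -- The length of the tuple does not depend on x, and tuples with fewer than three entries are
  -- never in ℙ_j.
  · have hn : ∀ x, z x ∉ primeProblem e K j := by
      rintro x ⟨y, -, h⟩
      rw [hz] at h
      apply hT
      simp only [List.cons_append, List.nil_append, List.map_eq_cons_iff] at h
      obtain ⟨t, _, rfl, -, s, _, rfl, -, r, l, rfl, -⟩ := h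
      exact ⟨t, s, r, l, rfl⟩
    simp [hn]

/-! ### Local simulation by affine configurations -/

theorem update_affineEval (x : ℝ) (Z : ℕ+ → ℤ × ℤ) (m : ℕ+) (t : ℤ × ℤ) :
    (fun n => affineEval x (Function.update Z m t n)) =
      Function.update (fun n => affineEval x (Z n)) m (affineEval x t) := by
  funext n
  by_cases h : n = m
  · subst h; simp
  · simp [h]

/-- Near an irrational point, an instruction acts on affine configurations. -/
theorem Instr.eventually_exec {x₀ : ℝ} (hx : Irrational x₀) (c : Instr) (S : AffineConfig) :
    ∃ S' : AffineConfig, ∀ᶠ x in 𝓝 x₀, c.exec (S.at x) = S'.at x := by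
  cases c with
  | plus i j k =>
    refine ⟨⟨S.pc + 1, Function.update S.Z i (S.Z j + S.Z k), S.I⟩, .of_forall fun x => ?_⟩
    simp only [Instr.exec, AffineConfig.at, update_affineEval]
    congr 2
    simp [affineEval]
    ring
  | minus i j k =>
    refine ⟨⟨S.pc + 1, Function.update S.Z i (S.Z j - S.Z k), S.I⟩, .of_forall fun x => ?_⟩
    simp only [Instr.exec, AffineConfig.at, update_affineEval]
    congr 2
    simp [affineEval]
    ring
  | zero j =>
    refine ⟨⟨S.pc + 1, Function.update S.Z j (0, 0), S.I⟩, .of_forall fun x => ?_⟩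
    simp only [Instr.exec, AffineConfig.at, update_affineEval]
    congr 2
    simp [affineEval]
  | one j =>
    refine ⟨⟨S.pc + 1, Function.update S.Z j (0, 1), S.I⟩, .of_forall fun x => ?_⟩
    simp only [Instr.exec, AffineConfig.at, update_affineEval]
    congr 2
    simp [affineEval]
  | ifGe j l₁ l₂ =>
    -- The branch taken at x₀ is the label for all nearby points.
    refine ⟨⟨if 0 ≤ affineEval x₀ (S.Z j) then l₁ else l₂, S.Z, S.I⟩, ?_⟩
    filter_upwards [eventually_nonneg_affineEval_iff hx (S.Z j)] with x h
    simp only [Instr.exec, AffineConfig.at, h]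
  | copy j k =>
    -- Index registers do not depend on x, so indirect addressing reaches the same registers for
    -- every x.
    refine ⟨⟨S.pc + 1, Function.update S.Z (S.I j) (S.Z (S.I k)), S.I⟩, .of_forall fun x => ?_⟩
    simp only [Instr.exec, AffineConfig.at, update_affineEval]
  | idxOne j => exact ⟨⟨S.pc + 1, S.Z, Function.update S.I j 1⟩, .of_forall fun x => rfl⟩
  | idxSucc j =>
    exact ⟨⟨S.pc + 1, S.Z, Function.update S.I j (S.I j + 1)⟩, .of_forall fun x => rfl⟩
  | idxEq j k l₁ l₂ =>
    exact ⟨⟨if S.I j = S.I k then l₁ else l₂, S.Z, S.I⟩, .of_forall fun x => rfl⟩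

theorem AffineConfig.tuple_at (S : AffineConfig) (x : ℝ) :
    (S.at x).tuple.1 =
      ((List.range (S.I 1 : ℕ)).map fun m => S.Z m.succPNat).map (affineEval x) := by
  simp [Config.tuple, AffineConfig.at]

/-- This is where p_i ≠ p_j enters: the query answer at √p_i is the answer at all nearby points, so
one affine configuration describes the next step for all of them. -/
theorem OracleInstr.eventually_exec {i j : ℕ} (hp : prime i ≠ prime j) (c : OracleInstr)
    (S : AffineConfig) : ∃ S' : AffineConfig, ∀ᶠ x in 𝓝 √(prime i : ℝ),
      c.exec (primeProblem e K j) (S.at x) = S'.at x := by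
  classical
  cases c with
  | basic c => exact c.eventually_exec (irrational_sqrt_prime i) S
  | query l₁ l₂ =>
    refine ⟨⟨if (S.at √(prime i : ℝ)).tuple ∈ primeProblem e K j then l₁ else l₂, S.Z, S.I⟩, ?_⟩
    filter_upwards [eventually_mem_primeProblem_iff e K hp _ (fun x => (S.at x).tuple)
      S.tuple_at] with x h
    simp only [OracleInstr.exec, h]
    rfl

/-- A finite computation starting at `√p_i` is followed by all nearby inputs. -/
theorem eventually_reaches {i j : ℕ} (hp : prime i ≠ prime j) (M : OracleMachine)
    (S : AffineConfig) {c : Config}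
    (h : Reaches (step (OracleInstr.exec (primeProblem e K j)) M) (S.at √(prime i : ℝ)) c) :
    ∃ S' : AffineConfig, c = S'.at √(prime i : ℝ) ∧ ∀ᶠ x in 𝓝 √(prime i : ℝ),
      Reaches (step (OracleInstr.exec (primeProblem e K j)) M) (S.at x) (S'.at x) := by
  induction h with
  | refl => exact ⟨S, rfl, .of_forall fun x => .refl⟩
  | tail _ hs ih =>
    obtain ⟨S₁, rfl, hr⟩ := ih
    simp only [step, Option.mem_def, Option.map_eq_some_iff] at hs
    obtain ⟨q, hq, rfl⟩ := hs
    obtain ⟨S₂, hS₂⟩ := q.eventually_exec e K hp S₁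
    -- A property holding near √p_i holds at √p_i itself, which identifies the next configuration of
    -- the actual run.
    refine ⟨S₂, hS₂.self_of_nhds, ?_⟩
    -- Each step of the run shrinks the neighbourhood once, and the run is finite.
    filter_upwards [hr, hS₂] with x h1 h2
    refine h1.tail ?_
    simp only [step, Option.mem_def, Option.map_eq_some_iff]
    exact ⟨q, hq, h2⟩

/-! ### The contradiction at √p_i -/

/-- The tuple `(2 . (i, x) . code(K))`. -/
def primeInput (i : ℕ) (x : ℝ) : RInf := ⟨[2, (i : ℝ), x] ++ K.code e, by simp⟩

theorem primeInput_mem_iff (i : ℕ) (x : ℝ) :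
    primeInput e K i x ∈ primeProblem e K i ↔ x ≠ √(prime i : ℝ) := by
  rw [mem_primeProblem_iff e K i _ 2 i x (K.code e) rfl]
  simp

theorem exists_affineConfig_init (i : ℕ) :
    ∃ S : AffineConfig, ∀ x, init (primeInput e K i x) = S.at x := by
  have hl : ∃ l : List (ℤ × ℤ), ∀ x, l.map (affineEval x) = K.code e := by
    have := K.code_isInt e
    generalize K.code e = w at this
    induction w with
    | nil => exact ⟨[], by simp⟩
    | cons r w ih =>
      obtain ⟨n, rfl⟩ := this r (by simp)
      obtain ⟨l, hl⟩ := ih fun s hs => this s (by simp [hs])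
      exact ⟨(0, n) :: l, fun x => by simp [hl, affineEval]⟩
  obtain ⟨l, hl⟩ := hl
  -- The third entry is the variable, the form (1, 0); all others are integer constants. The index
  -- registers contain the input length, which is the same for every x, so it is read off at x = 0.
  refine ⟨⟨0, fun m => ((0, 2) :: (0, (i : ℤ)) :: (1, 0) :: l).getD m.natPred (0, 0),
    fun _ => (primeInput e K i 0).len⟩, fun x => ?_⟩
  have hx : (primeInput e K i x).1 =
      ((0, 2) :: (0, (i : ℤ)) :: (1, 0) :: l).map (affineEval x) := by
    simp [primeInput, hl, affineEval]
  -- The registers beyond the input contain the default value 0, written as the value of the zero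
  -- form so that `List.getD_map` applies.
  have h0 : (0 : ℝ) = affineEval x (0, 0) := by simp [affineEval]
  simp only [init, AffineConfig.at, Config.mk.injEq, true_and]
  constructor
  · funext m
    rw [hx, h0, List.getD_map]
  · rfl

theorem not_reducible_primeProblem {i j : ℕ} (hp : prime i ≠ prime j) :
    ¬ (primeProblem e K i ≼ primeProblem e K j) := by
  rintro ⟨M, hM⟩
  obtain ⟨S, hS⟩ := exists_affineConfig_init e K i
  have hx := irrational_sqrt_prime i
  -- √p_i is the one excluded point of ℙ_i, so the machine stops there with output 0.
  have h₀ := (hM (primeInput e K i √(prime i : ℝ))).2 (by simp [primeInput_mem_iff])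
  rw [compute, Part.eq_some_iff, Part.mem_map_iff] at h₀
  obtain ⟨c, hc, hout⟩ := h₀
  rw [mem_eval, hS] at hc
  obtain ⟨hreach, hnone⟩ := hc
  obtain ⟨S', rfl, hnear⟩ := eventually_reaches e K hp M S hreach
  have hzero := eventually_map_affineEval_eq_iff hx
    ((List.range (S'.I 1 : ℕ)).map fun m => S'.Z m.succPNat) [0] (by simpa using ⟨0, by simp⟩)
  simp only [← S'.tuple_at] at hzero
  have hout' : (S'.at √(prime i : ℝ)).tuple.1 = [0] := congrArg Subtype.val hout
  -- Punctured neighbourhoods in ℝ are never empty, so some x ≠ √p_i follows the same run and has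
  -- output `[0]` exactly when √p_i has.
  obtain ⟨x, ⟨h1, h2⟩, hne⟩ := (((hnear.and hzero).filter_mono nhdsWithin_le_nhds).and
    (self_mem_nhdsWithin : ({√(prime i : ℝ)}ᶜ : Set ℝ) ∈ 𝓝[≠] √(prime i : ℝ))).exists
  have h3 := (hM (primeInput e K i x)).1 ((primeInput_mem_iff e K i x).2 hne)
  have h4 : S'.at x ∈ eval (step (OracleInstr.exec (primeProblem e K j)) M)
      (init (primeInput e K i x)) := by
    rw [mem_eval, hS]
    -- Stopping depends only on the label, which `S'.at x` shares with the final configuration at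
    -- √p_i.
    exact ⟨h1, by simpa [step, AffineConfig.at] using hnone⟩
  rw [compute, Part.eq_some_iff, Part.mem_map_iff] at h3
  obtain ⟨c, hc, hcout⟩ := h3
  -- The evaluation is single-valued, so the configuration with output 1 is the one whose output was
  -- shown to be 0.
  obtain rfl := Part.mem_unique hc h4
  have h5 := h2.2 hout'
  rw [hcout] at h5
  simp [RInf.single] at h5

end AddBSS

theorem mainTheorem9 {b : ℕ} (e : AddBSS.Sym → Fin b → Bool) (he : Function.Injective e)
    (K : AddBSS.Machine) (hK : K.SemiDecides AddBSS.sqrtProblem)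
    (i j : ℕ) (hi : 1 ≤ i) (hj : 1 ≤ j) (hij : i ≠ j) :
    ¬ (AddBSS.primeProblem e K i ≼ AddBSS.primeProblem e K j) ∧
      ¬ (AddBSS.primeProblem e K j ≼ AddBSS.primeProblem e K i) :=
  ⟨AddBSS.not_reducible_primeProblem e K (AddBSS.prime_ne_prime hi hj hij),
    AddBSS.not_reducible_primeProblem e K (AddBSS.prime_ne_prime hj hi hij.symm)⟩
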